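/- For $b,c\in\mathbb Z$ and $n\in\mathbb N=\{0,1,2,\dots\}$ let $T_n(b,c)$ denote the coefficient of $x^n$ in the expansion of $(x^2+bx+c)^n$. For a prime $p$ and an integer $a$ with $p\nmid a$ let $q_p(a)=(a^{p-1}-1)/p$ be the Fermat quotient, let $\left(\frac{\cdot}{p}\right)$ be the Legendre symbol, and set $$S_{p-1}(x)=\sum_{k=1}^{p-1}\frac{\binom{2k}{k}}{k}x^k .$$ For rational numbers $u,v$, the congruence $u\equiv v\pmod{p^2}$ means that $u$ and $v$ are $p$-integral (their denominators in lowest terms are prime to $p$) and $u-v=p^2w$ for some $p$-integral rational number $w$. **Theorem.** Let $p$ be an odd prime, let $b,c\in\mathbb Z$ and let $d=b^2-4c$. (i) If $p\nmid d$, then $$\sum_{k=0}^{p-1}\frac{T_k(b,c)^2}{(-d)^k}\equiv\sum_{l=0}^{(p-1)/2}\binom{2l}{l}^2\left(-\frac{c}{4d}\right)^l\pmod{p^2}.$$ (ii) If $m$ is an integer with $(m-d)^2=16mc$ and $p\nmid md(m-d)$, then $$\sum_{k=0}^{p-1}\frac{T_k(b,c)^2}{m^k}\equiv\left(\frac{-1}{p}\right)+\frac{pd}{d-m}\left(\frac{-1}{p}\right)\left(q_p(d)-q_p(m)+S_{p-1}\left(\frac{m+d}{4m}\right)-S_{p-1}\left(\frac{m+d}{4d}\right)\right)\pmod{p^2}.$$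 -/

import Mathlib

/-- The generalized central trinomial coefficient `T_n(b, c)`: the coefficient of `x ^ n` in the
expansion of `(x ^ 2 + b x + c) ^ n`. -/
noncomputable def genTrinomial (n : ℕ) (b c : ℤ) : ℤ :=
  ((Polynomial.X ^ 2 + Polynomial.C b * Polynomial.X + Polynomial.C c) ^ n).coeff n

/-- The Fermat quotient `q_p(a) = (a ^ (p - 1) - 1) / p`, as a rational number (it is an integer
when the prime `p` does not divide `a`). -/
def fermatQuotient (p : ℕ) (a : ℤ) : ℚ :=
  ((a : ℚ) ^ (p - 1) - 1) / (p : ℚ)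

/-- `S_{p-1}(x) = ∑_{k=1}^{p-1} C(2k, k) x ^ k / k`. -/
def centralBinomSum (p : ℕ) (x : ℚ) : ℚ :=
  ∑ k ∈ Finset.Icc 1 (p - 1), ((Nat.choose (2 * k) k : ℕ) : ℚ) / (k : ℚ) * x ^ k

/-- A rational number is `p`-integral (for a prime `p`: it lies in the ring of `p`-adic integers)
if `p` does not divide its denominator in lowest terms. -/
def RatPIntegral (p : ℕ) (x : ℚ) : Prop :=
  ¬ p ∣ x.den

/-- `x ≡ y (mod p ^ n)` in the ring of `p`-integral rationals: both sides are `p`-integral, and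
they differ by `p ^ n` times a `p`-integral rational number. -/
def RatModEq (p n : ℕ) (x y : ℚ) : Prop :=
  RatPIntegral p x ∧ RatPIntegral p y ∧
    ∃ z : ℚ, RatPIntegral p z ∧ x - y = (p : ℚ) ^ n * z

/-! Write `p = 2n + 1`, `t = d/m`, `y = (1-t)²/t`. The starting point is the Clausen-type identity
`genTrinomial_sq`: `T_i² = ∑_k C(i+k,2k) C(2k,k)² c^k d^(i-k)`. Summing over `i < p` gives `∑_k
C(2k,k)² (c/d)^k F_k(t)`, where `F_k(t) = ∑_{i<p} C(i+k,2k) t^i` truncates `t^k/(1-t)^(2k+1)`. Terms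
with `k > n` vanish mod `p²`. Without truncation `y F_{k+1} = F_k`; truncation adds boundary
binomials divisible by `p`. With `a_k = (-1)^k/((2k+1) C(2k,k))` this gives `y^k F_k ≡ F_0 - p
(1+t)/2 ∑_{j<k} y^j a_j` mod `p²` (`congMod_pow_mul_truncBinomSeries`).

For (i), `t = -1`: the correction vanishes, `F_0 = 1` and `y = -4`.

For (ii), the condition on `m` says `c/d = y/16`, and `C(2k,k)²/16^k` is congruent mod `p²` to a
coefficient of the shifted Legendre polynomial of degree `n`. These coefficients sum to `(-1)^n`,
which multiplies `F_0`; the geometric sum `F_0` yields the Fermat quotients. The correction is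
summed exactly (`sum_legendreCoeff_mul_sum`, `sum_pow_mul_altChooseSum`) to a multiple of `∑_{i≤n}
((-t)^i - (-1/t)^i)/i`, which mod `p` is the difference of the two values of `S_{p-1}`
(`congMod_centralBinomSum_sub`). -/

/-! ### Arithmetic of `p`-integral rationals and congruences between them. -/

/-- The ring of `p`-integral rationals. -/
def pIntegers (p : ℕ) [hp : Fact p.Prime] : Subring ℚ where
  carrier := {x | RatPIntegral p x}
  mul_mem' {x y} hx hy h := (hp.out.dvd_mul.mp (h.trans (Rat.mul_den_dvd x y))).elim hx hy
  one_mem' := by simpa [RatPIntegral] using hp.out.one_lt.ne'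
  add_mem' {x y} hx hy h := (hp.out.dvd_mul.mp (h.trans (Rat.add_den_dvd x y))).elim hx hy
  zero_mem' := by simpa [RatPIntegral] using hp.out.one_lt.ne'
  neg_mem' {x} hx := by simpa [RatPIntegral] using hx

theorem inv_intCast_mem_pIntegers {p : ℕ} [Fact p.Prime] {a : ℤ} (h : ¬ (p : ℤ) ∣ a) :
    (a : ℚ)⁻¹ ∈ pIntegers p := by
  intro hp
  apply h
  rcases eq_or_ne a 0 with rfl | ha
  · simp
  · rw [Rat.inv_intCast_den, if_neg ha] at hp
    exact Int.natCast_dvd.mpr hp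

theorem inv_natCast_mem_pIntegers {p : ℕ} [Fact p.Prime] {a : ℕ} (h : ¬ p ∣ a) :
    (a : ℚ)⁻¹ ∈ pIntegers p := by
  have := inv_intCast_mem_pIntegers (p := p) (a := a) (by exact_mod_cast h)
  simpa using this

theorem inv_mem_pIntegers_of_lt {p : ℕ} [Fact p.Prime] {a : ℕ} (h0 : 0 < a) (h : a < p) :
    (a : ℚ)⁻¹ ∈ pIntegers p :=
  inv_natCast_mem_pIntegers fun hd => (Nat.le_of_dvd h0 hd).not_gt h

/-- Congruence modulo `p ^ n` in the ring of `p`-integral rationals. -/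
def CongMod (p n : ℕ) [Fact p.Prime] (x y : ℚ) : Prop :=
  ∃ z ∈ pIntegers p, x - y = (p : ℚ) ^ n * z

namespace CongMod

variable {p n : ℕ} [Fact p.Prime] {x y z w a : ℚ}

theorem refl (x : ℚ) : CongMod p n x x := ⟨0, zero_mem _, by simp⟩

theorem of_eq (h : x = y) : CongMod p n x y := h ▸ refl x

theorem symm : CongMod p n x y → CongMod p n y x := fun ⟨z, hz, h⟩ =>
  ⟨-z, neg_mem hz, by linear_combination -h⟩

theorem trans : CongMod p n x y → CongMod p n y z → CongMod p n x z := fun ⟨u, hu, h⟩ ⟨v, hv, h'⟩ =>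
  ⟨u + v, add_mem hu hv, by linear_combination h + h'⟩

theorem add : CongMod p n x y → CongMod p n z w → CongMod p n (x + z) (y + w) :=
  fun ⟨u, hu, h⟩ ⟨v, hv, h'⟩ => ⟨u + v, add_mem hu hv, by linear_combination h + h'⟩

theorem sub : CongMod p n x y → CongMod p n z w → CongMod p n (x - z) (y - w) :=
  fun ⟨u, hu, h⟩ ⟨v, hv, h'⟩ => ⟨u - v, sub_mem hu hv, by linear_combination h - h'⟩

theorem mul_left (ha : a ∈ pIntegers p) : CongMod p n x y → CongMod p n (a * x) (a * y) :=
  fun ⟨u, hu, h⟩ => ⟨a * u, mul_mem ha hu, by linear_combination a * h⟩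

theorem mul_right (ha : a ∈ pIntegers p) : CongMod p n x y → CongMod p n (x * a) (y * a) :=
  fun ⟨u, hu, h⟩ => ⟨u * a, mul_mem hu ha, by linear_combination a * h⟩

/-- The correction terms carry a factor `p`, so they need only be known mod `p`. -/
theorem prime_mul : CongMod p n x y → CongMod p (n + 1) (p * x) (p * y) :=
  fun ⟨u, hu, h⟩ => ⟨u, hu, by rw [pow_succ]; linear_combination (p : ℚ) * h⟩

theorem sum {ι : Type*} {s : Finset ι} {f g : ι → ℚ} (h : ∀ i ∈ s, CongMod p n (f i) (g i)) :
    CongMod p n (∑ i ∈ s, f i) (∑ i ∈ s, g i) := by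
  classical
  induction s using Finset.induction_on with
  | empty => exact refl _
  | insert i s hi ih =>
    rw [Finset.sum_insert hi, Finset.sum_insert hi]
    exact (h i (Finset.mem_insert_self i s)).add
      (ih fun j hj => h j (Finset.mem_insert_of_mem hj))

theorem mem (h : CongMod p n x y) (hy : y ∈ pIntegers p) : x ∈ pIntegers p := by
  obtain ⟨z, hz, h⟩ := h
  rw [show x = y + (p : ℚ) ^ n * z by linear_combination h]
  exact add_mem hy (mul_mem (pow_mem (natCast_mem _ p) _) hz)

theorem ratModEq (h : CongMod p n x y) (hy : y ∈ pIntegers p) : RatModEq p n x y :=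
  ⟨h.mem hy, hy, h⟩

end CongMod

theorem congMod_one_pow_sub_one {p : ℕ} [Fact p.Prime] {a : ℤ} (h : ¬ (p : ℤ) ∣ a) :
    CongMod p 1 ((a : ℚ) ^ (p - 1)) 1 := by
  have hc : IsCoprime a (p : ℤ) :=
    ((Nat.prime_iff_prime_int.mp Fact.out).coprime_iff_not_dvd.mpr h).symm
  obtain ⟨z, hz⟩ := (Int.ModEq.pow_card_sub_one_eq_one Fact.out hc).symm.dvd
  refine ⟨z, intCast_mem _ z, ?_⟩
  rw [pow_one]
  exact_mod_cast hz

theorem congMod_one_pow_prime {p : ℕ} [Fact p.Prime] {x : ℚ} (hx : x ∈ pIntegers p) :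
    CongMod p 1 (x ^ p) x := by
  have hden : (x.den : ℚ) ≠ 0 := by exact_mod_cast x.den_ne_zero
  have hx' : (x.den : ℚ)⁻¹ ∈ pIntegers p := inv_natCast_mem_pIntegers hx
  have fermat : ∀ a : ℤ, CongMod p 1 ((a : ℚ) ^ p) a := by
    intro a
    have h := ZMod.pow_card (a : ZMod p)
    rw [← Int.cast_pow, ZMod.intCast_eq_intCast_iff] at h
    obtain ⟨z, hz⟩ := h.symm.dvd
    refine ⟨z, intCast_mem _ z, ?_⟩
    rw [pow_one]
    exact_mod_cast hz
  -- As `num = x * den`, the two sides differ by `den^p (x^p - x)`; the factor `den^p` is then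
  -- inverted.
  have h1 := (fermat x.num).sub ((fermat x.den).mul_left hx)
  obtain ⟨z, hz, h⟩ := h1.mul_left (pow_mem hx' p)
  refine ⟨z, hz, ?_⟩
  rw [← h]
  push_cast
  have hxe : x * x.den = x.num := Rat.mul_den_eq_num x
  rw [← hxe, mul_pow]
  have : ((x.den : ℚ)⁻¹) ^ p * (x.den : ℚ) ^ p = 1 := by
    rw [← mul_pow, inv_mul_cancel₀ hden, one_pow]
  linear_combination (x - x ^ p) * this

namespace TrinomialSquare

open Polynomial

/-! ### The square of a trinomial coefficient, via the Legendre equation. -/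

theorem choose_add_succ_two_mul (n k : ℕ) :
    ((n + (k + 1)).choose (2 * (k + 1)) : ℚ) * ((2 * k + 1) * (2 * k + 2)) =
      (n + k + 1) * (n - k) * ((n + k).choose (2 * k) : ℚ) := by
  rcases lt_or_ge n k with h | h
  · rw [Nat.choose_eq_zero_of_lt (show n + (k + 1) < 2 * (k + 1) by omega),
      Nat.choose_eq_zero_of_lt (show n + k < 2 * k by omega)]
    simp
  · obtain ⟨j, rfl⟩ := Nat.exists_eq_add_of_le h
    have h1 := Nat.add_one_mul_choose_eq (k + j + k) (2 * k + 1)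
    have h2 := Nat.choose_succ_right_eq (k + j + k) (2 * k)
    rw [show k + j + k - 2 * k = j by omega] at h2
    rw [show k + j + (k + 1) = k + j + k + 1 by ring, show 2 * (k + 1) = 2 * k + 1 + 1 by ring]
    have h1' := congrArg (Nat.cast : ℕ → ℚ) h1
    have h2' := congrArg (Nat.cast : ℕ → ℚ) h2
    push_cast at h1' h2' ⊢
    linear_combination -(2 * (k : ℚ) + 1) * h1' + ((k : ℚ) + j + k + 1) * h2'

theorem succ_mul_centralChoose_succ (k : ℕ) :
    ((k : ℚ) + 1) * ((2 * (k + 1)).choose (k + 1) : ℚ) =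
      2 * (2 * k + 1) * ((2 * k).choose k : ℚ) := by
  exact_mod_cast Nat.succ_mul_centralBinom_succ k

/-- The symmetric square of the Legendre operator `f ↦ (q f')' - N f`. -/
noncomputable def symSqOp (q : ℚ[X]) (N : ℚ) : ℚ[X] →ₗ[ℚ] ℚ[X] :=
  derivative ∘ₗ LinearMap.mulLeft ℚ q ∘ₗ
      (derivative ∘ₗ LinearMap.mulLeft ℚ q ∘ₗ derivative - (2 * N) • LinearMap.id) -
    (2 * N) • (LinearMap.mulLeft ℚ q ∘ₗ derivative)

theorem symSqOp_apply (q : ℚ[X]) (N : ℚ) (f : ℚ[X]) :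
    symSqOp q N f = derivative (q * (derivative (q * derivative f) - C (2 * N) * f)) -
      C (2 * N) * (q * derivative f) := by
  simp [symSqOp, smul_eq_C_mul]

/-- The square of a solution of a second-order linear equation satisfies a third-order one; this
operator is that equation. -/
theorem symSqOp_sq {q f : ℚ[X]} {N : ℚ} (h : derivative (q * derivative f) = C N * f) :
    symSqOp q N (f ^ 2) = 0 := by
  have h1 : q * derivative (f ^ 2) = C 2 * f * (q * derivative f) := by
    rw [derivative_sq]; ring
  have h2 : derivative (q * derivative (f ^ 2)) =
      C 2 * q * derivative f ^ 2 + C (2 * N) * f ^ 2 := by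
    rw [h1, derivative_mul, h, derivative_C_mul, C_mul]; ring
  rw [symSqOp_apply, h2, h1]
  have h3 : q * (C 2 * q * derivative f ^ 2 + C (2 * N) * f ^ 2 - C (2 * N) * f ^ 2) =
      C 2 * (q * derivative f) ^ 2 := by ring
  rw [h3, derivative_C_mul, derivative_sq, h, C_mul]
  ring

/-- On powers of `q = X² - e` the operator has only two terms, so a solution expanded in `q` has a
two-term recurrence. For `k = 0` the truncated exponent `k - 1` is harmless because of the factor
`k^3`. -/
theorem symSqOp_pow (e N : ℚ) (k : ℕ) :
    symSqOp (X ^ 2 - C e) N ((X ^ 2 - C e) ^ k) = C 2 * X *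
      (C (2 * (2 * k + 1) * (k * (k + 1) - N)) * (X ^ 2 - C e) ^ k +
        C (4 * e * k ^ 3) * (X ^ 2 - C e) ^ (k - 1)) := by
  rw [symSqOp_apply]
  set q : ℚ[X] := X ^ 2 - C e with hq
  have hq' : derivative q = C 2 * X := by
    rw [hq, derivative_sub, derivative_X_sq, derivative_C, sub_zero]
  have hX : X ^ 2 = q + C e := by rw [hq]; ring
  have hpow : ∀ j : ℕ, derivative (q ^ (j + 1)) = C ((j : ℚ) + 1) * q ^ j * (C 2 * X) := by
    intro j; rw [derivative_pow, hq']; simp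
  rcases k with _ | j
  · simp only [pow_zero, derivative_one, mul_zero, derivative_zero, mul_one, zero_sub, mul_neg,
      derivative_neg, sub_zero]
    rw [mul_comm q, derivative_C_mul, hq']
    simp [C_mul]
    ring
  · have h1 : q * derivative (q ^ (j + 1)) = C ((j : ℚ) + 1) * (q ^ (j + 1) * (C 2 * X)) := by
      rw [hpow]; ring
    have h2 : derivative (q * derivative (q ^ (j + 1))) =
        C ((j : ℚ) + 1) * (C ((j : ℚ) + 1) * q ^ j * (C 4 * (q + C e)) + C 2 * q ^ (j + 1)) := by
      rw [h1, derivative_C_mul, derivative_mul, hpow, ← hX, derivative_C_mul, derivative_X]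
      have : (C 4 : ℚ[X]) = C 2 * C 2 := by rw [← C_mul]; norm_num
      rw [this]; ring
    have h3 : q * (derivative (q * derivative (q ^ (j + 1))) - C (2 * N) * q ^ (j + 1)) =
        C (((j : ℚ) + 1) * (4 * (j + 1) + 2) - 2 * N) * q ^ (j + 1 + 1) +
          C (4 * e * (j + 1) ^ 2) * q ^ (j + 1) := by
      rw [h2]
      simp only [C_mul, C_add, C_sub, C_1, C_pow]
      ring
    rw [h3, h1, derivative_add, derivative_C_mul, derivative_C_mul, hpow, hpow,
      Nat.add_sub_cancel]
    push_cast
    simp only [C_mul, C_add, C_sub, C_1, C_pow, map_natCast, map_ofNat]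
    ring

theorem coeff_quad_mul (e : ℚ) (A : ℚ[X]) (s : ℕ) :
    ((X ^ 2 - C e) * A).coeff (s + 2) = A.coeff s - e * A.coeff (s + 2) := by
  rw [sub_mul, coeff_sub, coeff_C_mul, coeff_X_pow_mul]

/-- The coefficient of `X^(r+1)` in the image is `(r+1)(r(r+2) - 2n(2n+2)) f_r` plus multiples of
`f_{r+2}` and `f_{r+4}`. The factor is nonzero for `r < 2n`, so coefficients vanish by descent from
the top. -/
theorem eq_zero_of_symSqOp_eq_zero {e : ℚ} {n : ℕ} {f : ℚ[X]}
    (h : symSqOp (X ^ 2 - C e) (n * (n + 1)) f = 0) (hf : ∀ s, 2 * n ≤ s → f.coeff s = 0) :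
    f = 0 := by
  have key : ∀ r : ℕ, f.coeff (r + 2) = 0 → f.coeff (r + 4) = 0 → r < 2 * n → f.coeff r = 0 := by
    intro r h2 h4 hr
    have := congrArg (fun g => coeff g (r + 1)) h
    rw [symSqOp_apply] at this
    rcases r with _ | r
    · simp only [coeff_sub, coeff_zero, coeff_derivative, coeff_C_mul] at this
      rw [show (0 + 1 + 1 : ℕ) = 0 + 2 by rfl, coeff_quad_mul] at this
      simp only [coeff_sub, coeff_derivative, coeff_C_mul] at this
      rw [show (0 + 2 + 1 : ℕ) = 1 + 2 by rfl, coeff_quad_mul] at this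
      simp only [sub_mul, coeff_sub, coeff_C_mul, coeff_derivative, coeff_X_pow_mul'] at this
      norm_num at this h2 h4
      rw [h2, h4] at this
      have hn : (0 : ℚ) < n := by exact_mod_cast (by omega : 0 < n)
      have hne : (n : ℚ) * (n + 1) ≠ 0 := by positivity
      have : (n : ℚ) * (n + 1) * f.coeff 0 = 0 := by linarith
      exact (mul_eq_zero.mp this).resolve_left hne
    · simp only [coeff_sub, coeff_zero, coeff_derivative, coeff_C_mul] at this
      rw [show (r + 1 + 1 + 1 : ℕ) = (r + 1) + 2 by rfl, coeff_quad_mul] at this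
      rw [show (r + 1 + 1 : ℕ) = r + 2 by rfl, coeff_quad_mul] at this
      simp only [coeff_sub, coeff_derivative, coeff_C_mul] at this
      rw [show (r + 1 + 1 : ℕ) = r + 2 by rfl, show (r + 1 + 2 + 1 : ℕ) = (r + 2) + 2 by rfl,
        coeff_quad_mul, coeff_quad_mul] at this
      simp only [coeff_derivative] at this
      rw [show r + 2 + 1 = r + 1 + 2 by ring, show r + 2 + 2 + 1 = r + 1 + 4 by ring, h2, h4]
        at this
      push_cast at this
      have h0 : ((r : ℚ) + 2) * ((r + 1) * (r + 3) - 4 * (n * (n + 1))) * f.coeff (r + 1) = 0 := by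
        linear_combination this
      have hr' : (r : ℚ) + 1 + 1 ≤ 2 * n := by exact_mod_cast hr
      have hr0 : (0 : ℚ) ≤ r := by positivity
      refine (mul_eq_zero.mp h0).resolve_left (mul_ne_zero (by positivity) ?_)
      nlinarith
  have all : ∀ j s : ℕ, 2 * n ≤ s + j → f.coeff s = 0 := by
    intro j
    induction j with
    | zero => intro s hs; exact hf s (by omega)
    | succ j ih =>
      intro s hs
      by_cases h' : 2 * n ≤ s
      · exact hf s h'
      · exact key s (ih _ (by omega)) (ih _ (by omega)) (by omega)
  ext s
  simpa using all (2 * n) s (by omega)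

theorem iterate_derivative_legendre_ode (e : ℚ) (n : ℕ) :
    derivative ((X ^ 2 - C e) * derivative (derivative^[n] ((X ^ 2 - C e) ^ n))) =
      C ((n : ℚ) * (n + 1)) * derivative^[n] ((X ^ 2 - C e) ^ n) := by
  set u : ℚ[X] := (X ^ 2 - C e) ^ n with hu
  -- This is `q u' = 2n X u` differentiated `j` times. At `j = n` the middle term drops out, and one
  -- more derivative gives the Legendre equation.
  have step : ∀ j : ℕ, (X ^ 2 - C e) * derivative^[j + 1] u =
      C (2 * ((n : ℚ) - j)) * X * derivative^[j] u +
        C ((j : ℚ) * (2 * n - j + 1)) * derivative^[j - 1] u := by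
    intro j
    induction j with
    | zero =>
      simp only [zero_add, Function.iterate_one, Function.iterate_zero, id]
      rw [hu, derivative_pow]
      rcases n with _ | n
      · simp
      · rw [derivative_sub, derivative_X_sq, derivative_C]
        simp
        ring
    | succ j ih =>
      have := congrArg derivative ih
      rw [derivative_mul, derivative_add, mul_assoc, derivative_C_mul, derivative_C_mul,
        derivative_mul, derivative_X, one_mul, ← Function.iterate_succ_apply' derivative,
        ← Function.iterate_succ_apply' derivative] at this
      have h3 : C ((j : ℚ) * (2 * n - j + 1)) * derivative (derivative^[j - 1] u) =
          C ((j : ℚ) * (2 * n - j + 1)) * derivative^[j] u := by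
        rcases j with _ | j
        · simp
        · rw [← Function.iterate_succ_apply' derivative]; rfl
      rw [h3] at this
      have h4 : derivative (X ^ 2 - C e) = (C 2 * X : ℚ[X]) := by
        rw [derivative_sub, derivative_X_sq, derivative_C, sub_zero]
      rw [h4] at this
      rw [Nat.add_sub_cancel]
      simp only [Nat.succ_eq_add_one] at this
      push_cast
      simp only [C_mul, C_add, C_sub, C_1, map_natCast, map_ofNat] at this ⊢
      linear_combination this
  have h1 := congrArg derivative (step n)
  rw [← Function.iterate_succ_apply' derivative, Nat.succ_eq_add_one, h1]
  rcases n with _ | n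
  · simp
  · simp only [sub_self, mul_zero, C_0, zero_mul, zero_add, derivative_C_mul, Nat.add_sub_cancel,
      ← Function.iterate_succ_apply' derivative]
    congr 2
    ring

/-- Completing the square: the shift by `b/2` turns `X² - d/4` into `X² + bX + c`, and Taylor
coefficients are Hasse derivatives (Rodrigues' formula). -/
theorem genTrinomial_eq_eval (n : ℕ) (b c d : ℤ) (hd : d = b ^ 2 - 4 * c) :
    (genTrinomial n b c : ℚ) =
      (hasseDeriv n ((X ^ 2 - C ((d : ℚ) / 4)) ^ n)).eval ((b : ℚ) / 2) := by
  rw [← taylor_coeff, genTrinomial]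
  have : taylor ((b : ℚ) / 2) ((X ^ 2 - C ((d : ℚ) / 4)) ^ n) =
      ((X ^ 2 + C b * X + C c) ^ n : ℤ[X]).map (Int.castRingHom ℚ) := by
    rw [taylor_apply]
    simp only [pow_comp, sub_comp, X_comp, C_comp, Polynomial.map_pow, Polynomial.map_add,
      Polynomial.map_mul, map_X, map_C, Int.coe_castRingHom]
    congr 1
    have h1 : (C (b : ℚ) : ℚ[X]) = C 2 * C ((b : ℚ) / 2) := by rw [← C_mul]; congr 1; ring
    have h2 : (C (c : ℚ) : ℚ[X]) = C ((b : ℚ) / 2) ^ 2 - C ((d : ℚ) / 4) := by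
      rw [← C_pow, ← C_sub]; congr 1; rw [hd]; push_cast; ring
    rw [h1, h2, map_ofNat]
    ring
  rw [this, coeff_map]
  simp

/-- With `q = X² - d/4` one has `q(b/2) = c`, so the right side is the value at `b/2` of a
polynomial `H` in `q`. Both `P²` and `H` are killed by the symmetric square and share the
coefficient `C(2n,n)²` of `X^(2n)`, hence agree. -/
theorem genTrinomial_sq (n : ℕ) (b c d : ℤ) (hd : d = b ^ 2 - 4 * c) :
    (genTrinomial n b c : ℚ) ^ 2 = ∑ k ∈ Finset.range (n + 1),
      ((n + k).choose (2 * k) : ℚ) * ((2 * k).choose k : ℚ) ^ 2 * (c : ℚ) ^ k *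
        (d : ℚ) ^ (n - k) := by
  set e : ℚ := (d : ℚ) / 4 with he
  set q : ℚ[X] := X ^ 2 - C e with hq
  set P : ℚ[X] := hasseDeriv n (q ^ n) with hP
  set α : ℕ → ℚ := fun k => ((n + k).choose (2 * k) : ℚ) * ((2 * k).choose k : ℚ) ^ 2 *
    (d : ℚ) ^ (n - k) with hα
  set H : ℚ[X] := ∑ k ∈ Finset.range (n + 1), α k • q ^ k with hH
  have hPiter : C (n.factorial : ℚ) * P = derivative^[n] (q ^ n) := by
    rw [← factorial_smul_hasseDeriv, LinearMap.smul_apply, nsmul_eq_mul, map_natCast]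
  have hode : derivative (q * derivative P) = C ((n : ℚ) * (n + 1)) * P := by
    have hfac : (C (n.factorial : ℚ) : ℚ[X]) ≠ 0 := by
      rw [Ne, C_eq_zero]; exact_mod_cast n.factorial_ne_zero
    apply mul_left_cancel₀ hfac
    have := iterate_derivative_legendre_ode e n
    rw [← hq, ← hPiter, derivative_C_mul] at this
    rw [← derivative_C_mul, mul_left_comm, this]
    ring
  have hα_succ : ∀ k ≤ n, 2 * (2 * (k : ℚ) + 1) * (k * (k + 1) - n * (n + 1)) * α k =
      -(4 * e * ((k : ℚ) + 1) ^ 3 * α (k + 1)) := by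
    intro k hk
    rcases hk.eq_or_lt with rfl | hk
    · simp only [hα]
      rw [Nat.choose_eq_zero_of_lt (show k + (k + 1) < 2 * (k + 1) by omega)]
      push_cast; ring
    · have h1 := choose_add_succ_two_mul n k
      have h2 := succ_mul_centralChoose_succ k
      obtain ⟨j, rfl⟩ := Nat.exists_eq_add_of_lt hk
      have h3 : k + j + 1 - k = j + 1 := by omega
      have h4 : k + j + 1 - (k + 1) = j := by omega
      simp only [hα, h3, h4]
      rw [he, pow_succ]
      set A := ((k + j + 1 + (k + 1)).choose (2 * (k + 1)) : ℚ)
      set A' := ((k + j + 1 + k).choose (2 * k) : ℚ)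
      set Z := ((2 * (k + 1)).choose (k + 1) : ℚ)
      set Z' := ((2 * k).choose k : ℚ)
      have hk1 : (2 * (k : ℚ) + 1) * (2 * k + 2) ≠ 0 := by positivity
      apply mul_left_cancel₀ hk1
      linear_combination ((d : ℚ) ^ j * d * (k + 1) ^ 3 * Z ^ 2) * h1 +
        (d : ℚ) ^ j * d * (k + 1) *
          ((((k + j + 1 : ℕ) : ℚ) + k + 1) * (((k + j + 1 : ℕ) : ℚ) - k) * A') *
            ((k + 1) * Z + 2 * (2 * k + 1) * Z') * h2
  -- The recurrence for `α` makes the images telescope; the ends vanish through `k^3` at `0` and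
  -- `C(2n+1,2n+2)` at `n + 1`.
  have hHode : symSqOp q (n * (n + 1)) H = 0 := by
    have : ∀ k ∈ Finset.range (n + 1), symSqOp q (n * (n + 1)) (α k • q ^ k) =
        C 2 * X * C (4 * e * k ^ 3 * α k) * q ^ (k - 1) -
          C 2 * X * C (4 * e * ((k + 1 : ℕ) : ℚ) ^ 3 * α (k + 1)) * q ^ (k + 1 - 1) := by
      intro k hk
      have h := congrArg C (hα_succ k (Nat.lt_succ_iff.mp (Finset.mem_range.mp hk)))
      rw [map_smul, symSqOp_pow, smul_eq_C_mul, ← hq, Nat.add_sub_cancel]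
      push_cast at h ⊢
      rw [C_mul, C_neg] at h
      rw [C_mul (b := α k)]
      linear_combination C 2 * X * q ^ k * h
    rw [hH, map_sum, Finset.sum_congr rfl this, Finset.sum_range_sub']
    simp [hα, Nat.choose_eq_zero_of_lt (show n + (n + 1) < 2 * (n + 1) by omega)]
  have hqdeg : q.natDegree ≤ 2 := by rw [hq]; compute_degree
  have hqc : q.coeff 2 = 1 := by simp [hq]
  have hPdeg : P.natDegree ≤ n := by
    refine (natDegree_hasseDeriv_le _ _).trans ?_
    have := natDegree_pow_le_of_le n hqdeg
    omega
  have hPc : P.coeff n = (2 * n).choose n := by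
    rw [hP, hasseDeriv_coeff, show n + n = n * 2 by ring, coeff_pow_of_natDegree_le hqdeg, hqc]
    simp [mul_comm]
  have hzero : P ^ 2 - H = 0 := by
    apply eq_zero_of_symSqOp_eq_zero (e := e) (n := n)
    · rw [map_sub, ← hq, hHode, symSqOp_sq hode, sub_zero]
    · intro s hs
      rw [coeff_sub, hH, finsetSum_coeff]
      rcases hs.eq_or_lt with rfl | hs
      · rw [coeff_pow_of_natDegree_le hPdeg, hPc, Finset.sum_range_succ, Finset.sum_eq_zero]
        · rw [coeff_smul, mul_comm 2 n, coeff_pow_of_natDegree_le hqdeg, hqc]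
          simp [hα, ← two_mul, mul_comm]
        · intro k hk
          rw [coeff_smul, coeff_eq_zero_of_natDegree_lt, smul_zero]
          have := natDegree_pow_le_of_le k hqdeg
          have := Finset.mem_range.mp hk
          omega
      · rw [coeff_eq_zero_of_natDegree_lt, Finset.sum_eq_zero, sub_zero]
        · intro k hk
          rw [coeff_smul, coeff_eq_zero_of_natDegree_lt, smul_zero]
          have := natDegree_pow_le_of_le k hqdeg
          have := Finset.mem_range.mp hk
          omega
        · have := natDegree_pow_le_of_le 2 hPdeg
          omega
  have heval : q.eval ((b : ℚ) / 2) = c := by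
    simp only [hq, eval_sub, eval_pow, eval_X, eval_C, he, hd]
    push_cast; ring
  rw [genTrinomial_eq_eval n b c d hd, ← he, ← hq, ← hP, ← eval_pow, sub_eq_zero.mp hzero, hH,
    eval_finsetSum]
  refine Finset.sum_congr rfl fun k _ => ?_
  rw [eval_smul, eval_pow, heval, smul_eq_mul]
  simp only [hα]
  ring

/-! ### Exact evaluation of the correction sum. -/

/-- The coefficients `(-1)^k C(n+k, 2k) C(2k, k)` of the shifted Legendre polynomial. -/
def legendreCoeff (n k : ℕ) : ℚ :=
  (-1) ^ k * ((n + k).choose (2 * k) : ℚ) * ((2 * k).choose k : ℚ)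

/-- The numbers `(-1)^k / ((2k+1) C(2k, k))`. -/
def altInvCentral (k : ℕ) : ℚ :=
  (-1) ^ k / ((2 * k + 1) * ((2 * k).choose k : ℚ))

theorem centralChoose_ne_zero (k : ℕ) : ((2 * k).choose k : ℚ) ≠ 0 := by
  exact_mod_cast (Nat.choose_pos (by omega : k ≤ 2 * k)).ne'

theorem altInvCentral_succ (k : ℕ) :
    2 * (2 * (k : ℚ) + 3) * altInvCentral (k + 1) = -((k + 1) * altInvCentral k) := by
  have h := succ_mul_centralChoose_succ k
  have h0 := centralChoose_ne_zero k
  have h1 := centralChoose_ne_zero (k + 1)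
  have h2 : (2 * (k : ℚ) + 1) ≠ 0 := by positivity
  have h3 : (2 * (k : ℚ) + 3) ≠ 0 := by positivity
  have h3' : (2 * ((k : ℚ) + 1) + 1) ≠ 0 := by positivity
  simp only [altInvCentral]
  push_cast
  generalize ((2 * (k + 1)).choose (k + 1) : ℚ) = Z at *
  generalize ((2 * k).choose k : ℚ) = Z' at *
  field_simp
  rw [pow_succ]
  linear_combination ((2 * (k : ℚ) + 3) * (-1) ^ k) * h

/-- The reflection `x ↦ 1 - x` multiplies the shifted Legendre polynomial by `(-1)^n`, so its value
at `1` is `(-1)^n` times its constant term `1`. -/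
theorem sum_legendreCoeff (n : ℕ) :
    ∑ k ∈ Finset.range (n + 1), legendreCoeff n k = (-1) ^ n := by
  have h := Polynomial.shiftedLegendre_eval_symm n (1 : ℚ)
  rw [sub_self, Polynomial.aeval_eq_sum_range, Polynomial.aeval_eq_sum_range,
    Polynomial.natDegree_shiftedLegendre, Finset.sum_range_succ' _ n] at h
  rw [Finset.sum_range_succ'] at h ⊢
  simp only [Polynomial.coeff_shiftedLegendre, one_pow, zsmul_eq_mul, mul_one, pow_zero,
    Nat.choose_zero_right, Nat.add_zero, Nat.choose_self, Int.cast_one, Nat.cast_one, ne_eq,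
    Nat.add_eq_zero_iff, one_ne_zero, and_false, not_false_eq_true, zero_pow, smul_zero,
    Finset.sum_const_zero, zero_add] at h
  rw [← h]
  congr 1
  · refine Finset.sum_congr rfl fun k hk => ?_
    rw [legendreCoeff]
    push_cast
    have hk := Finset.mem_range.mp hk
    have := Nat.choose_mul (n := n + (k + 1)) (k := 2 * (k + 1)) (s := k + 1)
      (by omega)
    rw [show n + (k + 1) - (k + 1) = n by omega, show 2 * (k + 1) - (k + 1) = k + 1 by omega,
      ← Nat.choose_symm_add (a := n)] at this
    have := congrArg (Nat.cast : ℕ → ℚ) this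
    push_cast at this
    linear_combination (-1 : ℚ) ^ (k + 1) * this
  · simp [legendreCoeff]

/-- The sums `∑_{i=1}^n (-1)^i C(i+j, 2j+1) / i`. -/
def altChooseSum (n j : ℕ) : ℚ :=
  ∑ i ∈ Finset.range n, (-1) ^ (i + 1) * ((i + 1 + j).choose (2 * j + 1) : ℚ) / ((i : ℚ) + 1)

theorem choose_succ_odd (i j : ℕ) :
    ((i + 1 + (j + 1)).choose (2 * (j + 1) + 1) : ℚ) * ((2 * j + 3) * (2 * j + 2)) =
      ((i + 1) ^ 2 - (j + 1) ^ 2) * ((i + 1 + j).choose (2 * j + 1) : ℚ) := by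
  rcases lt_or_ge i j with h | h
  · rw [Nat.choose_eq_zero_of_lt (show i + 1 + (j + 1) < 2 * (j + 1) + 1 by omega),
      Nat.choose_eq_zero_of_lt (show i + 1 + j < 2 * j + 1 by omega)]
    simp
  · obtain ⟨l, rfl⟩ := Nat.exists_eq_add_of_le h
    have h1 := Nat.add_one_mul_choose_eq (j + l + 1 + j) (2 * j + 2)
    have h2 := Nat.choose_succ_right_eq (j + l + 1 + j) (2 * j + 1)
    rw [show j + l + 1 + j - (2 * j + 1) = l by omega] at h2
    rw [show j + l + 1 + (j + 1) = j + l + 1 + j + 1 by ring,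
      show 2 * (j + 1) + 1 = 2 * j + 2 + 1 by ring]
    have h1' := congrArg (Nat.cast : ℕ → ℚ) h1
    have h2' := congrArg (Nat.cast : ℕ → ℚ) h2
    push_cast at h1' h2' ⊢
    linear_combination -(2 * (j : ℚ) + 2) * h1' + ((j : ℚ) + l + 1 + j + 1) * h2'

theorem choose_even_eq (i j : ℕ) :
    ((i + 1 + j).choose (2 * j + 2) : ℚ) * (2 * j + 2) =
      ((i : ℚ) - j) * ((i + 1 + j).choose (2 * j + 1) : ℚ) := by
  rcases lt_or_ge i j with h | h
  · rw [Nat.choose_eq_zero_of_lt (show i + 1 + j < 2 * j + 2 by omega),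
      Nat.choose_eq_zero_of_lt (show i + 1 + j < 2 * j + 1 by omega)]
    simp
  · obtain ⟨l, rfl⟩ := Nat.exists_eq_add_of_le h
    have h2 := Nat.choose_succ_right_eq (j + l + 1 + j) (2 * j + 1)
    rw [show j + l + 1 + j - (2 * j + 1) = l by omega] at h2
    have h2' := congrArg (Nat.cast : ℕ → ℚ) h2
    push_cast at h2' ⊢
    linear_combination h2'

theorem choose_succ_even_eq (i j : ℕ) :
    ((i + 1 + j + 1).choose (2 * j + 2) : ℚ) * (2 * j + 2) =
      ((i : ℚ) + j + 2) * ((i + 1 + j).choose (2 * j + 1) : ℚ) := by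
  have h := congrArg (Nat.cast : ℕ → ℚ) (Nat.add_one_mul_choose_eq (i + 1 + j) (2 * j + 1))
  push_cast at h
  linear_combination -h

theorem sum_alt_choose_mul (n j : ℕ) :
    ∑ i ∈ Finset.range n, (-1 : ℚ) ^ (i + 1) * ((i + 1 + j).choose (2 * j + 1) : ℚ) * (i + 1) =
      (-1) ^ n * (j + 1) * ((n + j + 1).choose (2 * j + 2) : ℚ) := by
  induction n with
  | zero => simp [Nat.choose_eq_zero_of_lt (show j + 1 < 2 * j + 2 by omega)]
  | succ n ih =>
    rw [Finset.sum_range_succ, ih, show n + j + 1 = n + 1 + j by ring]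
    have h1 := choose_even_eq n j
    have h2 := choose_succ_even_eq n j
    rw [pow_succ]
    linear_combination (-1 : ℚ) ^ n * (h1 + h2) / 2

/-- In `choose_succ_odd`, dividing `i² - (j+1)²` by `i` leaves `i - (j+1)²/i`: the first part is
summed by `sum_alt_choose_mul`, the second gives the sum for `j`. -/
theorem altChooseSum_succ (n j : ℕ) :
    2 * (2 * (j : ℚ) + 3) * altChooseSum n (j + 1) + (j + 1) * altChooseSum n j =
      (-1) ^ n * ((n + j + 1).choose (2 * j + 2) : ℚ) := by
  have hj : (j : ℚ) + 1 ≠ 0 := by positivity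
  apply mul_left_cancel₀ hj
  rw [altChooseSum, altChooseSum, Finset.mul_sum, Finset.mul_sum, ← Finset.sum_add_distrib,
    Finset.mul_sum, show ((j : ℚ) + 1) * ((-1) ^ n * ((n + j + 1).choose (2 * j + 2) : ℚ)) =
      (-1) ^ n * (j + 1) * ((n + j + 1).choose (2 * j + 2) : ℚ) by ring, ← sum_alt_choose_mul]
  refine Finset.sum_congr rfl fun i _ => ?_
  have h := choose_succ_odd i j
  have hi : (i : ℚ) + 1 ≠ 0 := by positivity
  field_simp
  linear_combination h

/-- The bracket is the tail `∑_{k>j}` of the Legendre coefficients. Both sides satisfy the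
recurrence of `altChooseSum_succ` in `j`. -/
theorem altChooseSum_eq (n j : ℕ) :
    altChooseSum n j = -(-1) ^ n / 2 * altInvCentral j *
      ((-1) ^ n - ∑ k ∈ Finset.range (j + 1), legendreCoeff n k) := by
  have hsq : ((-1 : ℚ) ^ n) ^ 2 = 1 := by rw [← pow_mul, mul_comm, pow_mul]; simp
  induction j with
  | zero =>
    have : altChooseSum n 0 = ((-1) ^ n - 1) / 2 := by
      induction n with
      | zero => simp [altChooseSum]
      | succ n ih =>
        have hn : (n : ℚ) + 1 ≠ 0 := by positivity
        rw [altChooseSum] at ih ⊢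
        rw [Finset.sum_range_succ, ih (by rw [← pow_mul, mul_comm, pow_mul]; simp), pow_succ]
        simp only [add_zero, mul_zero, zero_add, Nat.choose_one_right]
        push_cast
        rw [mul_div_assoc, div_self hn]
        ring
    rw [this]
    simp [legendreCoeff, altInvCentral]
    linear_combination hsq / 2
  | succ j ih =>
    have h := altChooseSum_succ n j
    have he := altInvCentral_succ j
    have hj : 2 * (2 * (j : ℚ) + 3) ≠ 0 := by positivity
    apply mul_left_cancel₀ hj
    rw [Finset.sum_range_succ]
    set τ := (-1) ^ n - ∑ k ∈ Finset.range (j + 1), legendreCoeff n k with hτ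
    rw [← sub_sub, ← hτ]
    have ha : (j + 1) * altInvCentral j * legendreCoeff n (j + 1) =
        -(2 * ((n + j + 1).choose (2 * j + 2) : ℚ)) := by
      have hc := succ_mul_centralChoose_succ j
      have h0 := centralChoose_ne_zero j
      have h2 : (2 * (j : ℚ) + 1) ≠ 0 := by positivity
      have hs : ((-1 : ℚ) ^ j) ^ 2 = 1 := by rw [← pow_mul, mul_comm, pow_mul]; simp
      rw [legendreCoeff, altInvCentral, show n + (j + 1) = n + j + 1 by ring]
      rw [show 2 * j + 2 = 2 * (j + 1) by ring]
      field_simp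
      rw [pow_succ]
      linear_combination (-((n + j + 1).choose (2 * (j + 1)) : ℚ)) * hc * ((-1 : ℚ) ^ j) ^ 2 -
        ((n + j + 1).choose (2 * (j + 1)) : ℚ) * (2 * (2 * j + 1) * ((2 * j).choose j : ℚ)) * hs
    linear_combination h - (j + 1) * ih + (-1) ^ n / 2 * (τ - legendreCoeff n (j + 1)) * he +
      (-1) ^ n / 2 * ha

theorem sum_legendreCoeff_mul_sum (n : ℕ) (y : ℚ) :
    ∑ k ∈ Finset.range (n + 1), legendreCoeff n k *
        ∑ j ∈ Finset.range k, y ^ j * altInvCentral j =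
      -2 * (-1) ^ n * ∑ j ∈ Finset.range n, y ^ j * altChooseSum n j := by
  have hsq : ((-1 : ℚ) ^ n) ^ 2 = 1 := by rw [← pow_mul, mul_comm, pow_mul]; simp
  simp_rw [Finset.mul_sum]
  rw [Finset.sum_comm' (t' := Finset.range n) (s' := fun j => Finset.Ico (j + 1) (n + 1))]
  · refine Finset.sum_congr rfl fun j hj => ?_
    have hj := Finset.mem_range.mp hj
    rw [← Finset.sum_mul, Finset.sum_Ico_eq_sub _ (by omega), sum_legendreCoeff, altChooseSum_eq]
    linear_combination -(y ^ j * altInvCentral j *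
      ((-1) ^ n - ∑ k ∈ Finset.range (j + 1), legendreCoeff n k)) * hsq
  · intro k j
    simp only [Finset.mem_range, Finset.mem_Ico]
    omega

/-- Here `y = t - 2 + 1/t`; these are Chebyshev-type polynomials in `y`. Pascal's rule couples the
odd and even sums, so they are proved together. -/
theorem sum_choose_odd_even {t : ℚ} (ht : t ≠ 0) (i : ℕ) :
    (t ^ 2 - 1) * ∑ j ∈ Finset.range i,
        ((i + j).choose (2 * j + 1) : ℚ) * ((1 - t) ^ 2 / t) ^ j = t * (t ^ i - t⁻¹ ^ i) ∧
    (1 + t) * ∑ j ∈ Finset.range (i + 1),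
        ((i + j).choose (2 * j) : ℚ) * ((1 - t) ^ 2 / t) ^ j = t * t ^ i + t⁻¹ ^ i := by
  set y := (1 - t) ^ 2 / t with hy
  have hyt : t * y = (1 - t) ^ 2 := by rw [hy]; field_simp
  have htt : t * t⁻¹ = 1 := mul_inv_cancel₀ ht
  induction i with
  | zero => constructor <;> simp [add_comm]
  | succ i ih =>
    obtain ⟨hU, hW⟩ := ih
    have h1 : ∑ j ∈ Finset.range (i + 1), ((i + 1 + j).choose (2 * j + 1) : ℚ) * y ^ j =
        ∑ j ∈ Finset.range i, ((i + j).choose (2 * j + 1) : ℚ) * y ^ j +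
          ∑ j ∈ Finset.range (i + 1), ((i + j).choose (2 * j) : ℚ) * y ^ j := by
      have : ∑ j ∈ Finset.range i, ((i + j).choose (2 * j + 1) : ℚ) * y ^ j =
          ∑ j ∈ Finset.range (i + 1), ((i + j).choose (2 * j + 1) : ℚ) * y ^ j := by
        rw [Finset.sum_range_succ, Nat.choose_eq_zero_of_lt (show i + i < 2 * i + 1 by omega)]
        simp
      rw [this, ← Finset.sum_add_distrib]
      refine Finset.sum_congr rfl fun j _ => ?_
      rw [show i + 1 + j = i + j + 1 by ring, Nat.choose_succ_succ]
      push_cast; ring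
    have h2 : ∑ j ∈ Finset.range (i + 1 + 1), ((i + 1 + j).choose (2 * j) : ℚ) * y ^ j =
        ∑ j ∈ Finset.range (i + 1), ((i + j).choose (2 * j) : ℚ) * y ^ j +
          y * ∑ j ∈ Finset.range (i + 1), ((i + 1 + j).choose (2 * j + 1) : ℚ) * y ^ j := by
      have : ∑ j ∈ Finset.range (i + 1), ((i + j).choose (2 * j) : ℚ) * y ^ j =
          ∑ j ∈ Finset.range (i + 1 + 1), ((i + j).choose (2 * j) : ℚ) * y ^ j := by
        rw [Finset.sum_range_succ _ (i + 1),
          Nat.choose_eq_zero_of_lt (show i + (i + 1) < 2 * (i + 1) by omega)]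
        simp
      rw [this, Finset.sum_range_succ' _ (i + 1), Finset.sum_range_succ' _ (i + 1), Finset.mul_sum]
      simp only [mul_zero, Nat.choose_zero_right, add_zero]
      rw [add_right_comm, ← Finset.sum_add_distrib]
      congr 1
      refine Finset.sum_congr rfl fun j _ => ?_
      rw [show i + 1 + (j + 1) = i + 1 + j + 1 by ring, show 2 * (j + 1) = 2 * j + 1 + 1 by ring,
        Nat.choose_succ_succ, show i + (j + 1) = i + 1 + j by ring]
      push_cast; ring
    set U := ∑ j ∈ Finset.range i, ((i + j).choose (2 * j + 1) : ℚ) * y ^ j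
    set W := ∑ j ∈ Finset.range (i + 1), ((i + j).choose (2 * j) : ℚ) * y ^ j
    have hU' : (t ^ 2 - 1) * (U + W) = t * (t ^ (i + 1) - t⁻¹ ^ (i + 1)) := by
      rw [pow_succ, pow_succ]
      linear_combination hU + (t - 1) * hW + t⁻¹ ^ i * htt
    rw [h2, h1]
    refine ⟨hU', ?_⟩
    have hts : (1 + t) * (y * (U + W)) = (t - 1) * (t ^ (i + 1) - t⁻¹ ^ (i + 1)) := by
      apply mul_left_cancel₀ ht
      linear_combination (1 + t) * (U + W) * hyt + (t - 1) * hU'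
    rw [mul_add, hW, hts, pow_succ, pow_succ]
    linear_combination (-t⁻¹ ^ i) * htt

theorem sum_pow_mul_altChooseSum {t : ℚ} (ht : t ≠ 0) (n : ℕ) :
    (t ^ 2 - 1) * ∑ j ∈ Finset.range n, ((1 - t) ^ 2 / t) ^ j * altChooseSum n j =
      t * ∑ i ∈ Finset.range n, ((-t) ^ (i + 1) - (-t⁻¹) ^ (i + 1)) / ((i : ℚ) + 1) := by
  set y := (1 - t) ^ 2 / t with hy
  simp_rw [altChooseSum, Finset.mul_sum]
  rw [Finset.sum_comm]
  refine Finset.sum_congr rfl fun i hi => ?_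
  have hi := Finset.mem_range.mp hi
  have h := (sum_choose_odd_even ht (i + 1)).1
  rw [← hy] at h
  rw [neg_pow t, neg_pow t⁻¹, ← mul_sub]
  rw [← Finset.sum_subset (s₁ := Finset.range (i + 1))]
  · rw [Finset.mul_sum] at h
    rw [← mul_div_assoc, mul_left_comm, ← h, Finset.mul_sum, Finset.sum_div]
    refine Finset.sum_congr rfl fun j _ => ?_
    ring
  · intro j; simp only [Finset.mem_range]; omega
  · intro j _ hj
    simp only [Finset.mem_range] at hj
    rw [Nat.choose_eq_zero_of_lt (show i + 1 + j < 2 * j + 1 by omega)]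
    simp

/-- Passing from `n` to `n + 1` adds `C(n+1,k+1)/(n+1)` to each `C(n,k+1)/(k+1)`; the increments sum
by the binomial theorem. -/
theorem sum_choose_mul_pow_div (n : ℕ) (s : ℚ) :
    ∑ k ∈ Finset.range n, (n.choose (k + 1) : ℚ) * (-s) ^ (k + 1) / ((k : ℚ) + 1) =
      ∑ i ∈ Finset.range n, ((1 - s) ^ (i + 1) - 1) / ((i : ℚ) + 1) := by
  induction n with
  | zero => simp
  | succ n ih =>
    have hn : (n : ℚ) + 1 ≠ 0 := by positivity
    have h1 : ∑ k ∈ Finset.range n, (n.choose (k + 1) : ℚ) * (-s) ^ (k + 1) / ((k : ℚ) + 1) =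
        ∑ k ∈ Finset.range (n + 1), (n.choose (k + 1) : ℚ) * (-s) ^ (k + 1) / ((k : ℚ) + 1) := by
      rw [Finset.sum_range_succ, Nat.choose_succ_self]; simp
    have h2 : ∑ k ∈ Finset.range (n + 1), ((n + 1).choose (k + 1) : ℚ) * (-s) ^ (k + 1) =
        (1 - s) ^ (n + 1) - 1 := by
      rw [sub_eq_neg_add 1 s, add_pow, Finset.sum_range_succ' _ (n + 1)]
      simp [mul_comm]
    rw [Finset.sum_range_succ (fun i : ℕ => ((1 - s) ^ (i + 1) - 1) / ((i : ℚ) + 1)), ← ih, h1,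
      ← h2, Finset.sum_div, ← Finset.sum_add_distrib]
    refine Finset.sum_congr rfl fun k _ => ?_
    have hk : (k : ℚ) + 1 ≠ 0 := by positivity
    have h3 := congrArg (Nat.cast : ℕ → ℚ) (Nat.add_one_mul_choose_eq n k)
    have h4 := congrArg (Nat.cast : ℕ → ℚ) (Nat.choose_succ_succ n k)
    push_cast at h3 h4
    field_simp
    simp only [Nat.succ_eq_add_one] at h4
    rw [h4] at h3 ⊢
    linear_combination (-s) ^ (k + 1) * h3

/-- The second difference of `C(N+k, 2k+2)` in `N` is `C(·, 2k)`; truncation at `N` leaves the two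
boundary terms. -/
theorem mul_sum_choose_mul_pow (k N : ℕ) (t : ℚ) :
    t * ∑ i ∈ Finset.range N, ((i + k).choose (2 * k) : ℚ) * t ^ i =
      (1 - t) ^ 2 * ∑ i ∈ Finset.range N, ((i + (k + 1)).choose (2 * (k + 1)) : ℚ) * t ^ i +
        t ^ N * ((N + k + 1).choose (2 * k + 2) : ℚ) -
          t ^ (N + 1) * ((N + k).choose (2 * k + 2) : ℚ) := by
  induction N with
  | zero =>
    simp [Nat.choose_eq_zero_of_lt (show k + 1 < 2 * k + 2 by omega),
      Nat.choose_eq_zero_of_lt (show k < 2 * k + 2 by omega)]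
  | succ N ih =>
    rw [Finset.sum_range_succ, Finset.sum_range_succ, mul_add, ih,
      show N + (k + 1) = N + k + 1 by ring, show 2 * (k + 1) = 2 * k + 2 by ring,
      show N + 1 + k + 1 = N + k + 1 + 1 by ring, show N + 1 + k = N + k + 1 by ring]
    have h : ((N + k + 1 + 1).choose (2 * k + 2) : ℚ) =
        2 * ((N + k + 1).choose (2 * k + 2) : ℚ) - ((N + k).choose (2 * k + 2) : ℚ) +
          ((N + k).choose (2 * k) : ℚ) := by
      rw [Nat.choose_succ_succ (N + k + 1), Nat.choose_succ_succ (N + k) (2 * k + 1),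
        Nat.choose_succ_succ (N + k) (2 * k)]
      push_cast; ring
    rw [h]
    ring

end TrinomialSquare

/-! ### Binomial congruences and the truncated series. -/

theorem CongMod.sum_range_of_le {p n : ℕ} [Fact p.Prime] {f : ℕ → ℚ} {N M : ℕ} (hNM : N ≤ M)
    (h : ∀ k, N ≤ k → k < M → CongMod p n (f k) 0) :
    CongMod p n (∑ k ∈ Finset.range M, f k) (∑ k ∈ Finset.range N, f k) := by
  rw [← Finset.sum_range_add_sum_Ico f hNM]
  have h0 : CongMod p n (∑ k ∈ Finset.Ico N M, f k) (∑ k ∈ Finset.Ico N M, 0) :=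
    CongMod.sum fun k hk => h k (Finset.mem_Ico.mp hk).1 (Finset.mem_Ico.mp hk).2
  rw [Finset.sum_const_zero] at h0
  simpa using (CongMod.refl (∑ k ∈ Finset.range N, f k)).add h0

namespace TrinomialSquare

variable {p n : ℕ} [Fact p.Prime]

theorem inv_two_pow_mem (hpn : p = 2 * n + 1) (a : ℕ) : ((2 : ℚ) ^ a)⁻¹ ∈ pIntegers p := by
  have hp : p.Prime := Fact.out
  have h2 : ((2 : ℕ) : ℚ)⁻¹ ∈ pIntegers p :=
    inv_mem_pIntegers_of_lt two_pos (by have := hp.two_le; omega)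
  rw [← inv_pow]
  exact pow_mem h2 a

theorem altInvCentral_mem (hpn : p = 2 * n + 1) {k : ℕ} (hk : k < n) :
    altInvCentral k ∈ pIntegers p := by
  induction k with
  | zero => simp [altInvCentral, one_mem]
  | succ k ih =>
    have h := altInvCentral_succ k
    have h3 : (((2 * (2 * k + 3) : ℕ)) : ℚ) ≠ 0 := by positivity
    have hinv : ((2 * (2 * k + 3) : ℕ) : ℚ)⁻¹ ∈ pIntegers p := by
      have h1 : ((2 * k + 3 : ℕ) : ℚ)⁻¹ ∈ pIntegers p :=
        inv_mem_pIntegers_of_lt (by omega) (by omega)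
      have h2 := inv_two_pow_mem (p := p) hpn 1
      rw [pow_one] at h2
      push_cast at h1 ⊢
      rw [mul_inv]
      exact mul_mem h2 h1
    have : altInvCentral (k + 1) =
        ((2 * (2 * k + 3) : ℕ) : ℚ)⁻¹ * -((k + 1 : ℕ) * altInvCentral k) := by
      rw [eq_inv_mul_iff_mul_eq₀ h3]
      push_cast
      linear_combination h
    rw [this]
    exact mul_mem hinv (neg_mem (mul_mem (natCast_mem _ _) (ih (by omega))))

/-- The recurrence in `k` has multiplier `p² - (k+1)²`; dropping `p²` leaves the recurrence of
`altInvCentral`. -/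
theorem congMod_choose_odd (hpn : p = 2 * n + 1) {k : ℕ} (hk : k < n) :
    CongMod p 2 ((p + k).choose (2 * k + 1) : ℚ) (p * altInvCentral k) := by
  induction k with
  | zero => exact CongMod.of_eq (by simp [altInvCentral])
  | succ k ih =>
    obtain ⟨z, hz, h⟩ := ih (by omega)
    have he := altInvCentral_succ k
    have hc := choose_succ_odd (2 * n) k
    rw [← hpn] at hc
    have hpn' : (p : ℚ) = 2 * n + 1 := by exact_mod_cast hpn
    have h1 : ((2 * k + 3 : ℕ) : ℚ)⁻¹ ∈ pIntegers p :=
      inv_mem_pIntegers_of_lt (by omega) (by omega)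
    have h2 : ((2 * k + 2 : ℕ) : ℚ)⁻¹ ∈ pIntegers p :=
      inv_mem_pIntegers_of_lt (by omega) (by omega)
    refine ⟨((2 * k + 3 : ℕ) : ℚ)⁻¹ * ((2 * k + 2 : ℕ) : ℚ)⁻¹ *
      (((p + k).choose (2 * k + 1) : ℕ) - (k + 1 : ℕ) ^ 2 * z),
      mul_mem (mul_mem h1 h2) (sub_mem (natCast_mem _ _)
        (mul_mem (pow_mem (natCast_mem _ _) _) hz)), ?_⟩
    have h3 : (2 * (k : ℚ) + 3) ≠ 0 := by positivity
    have h4 : (2 * (k : ℚ) + 2) ≠ 0 := by positivity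
    push_cast at hc ⊢
    rw [← hpn'] at hc
    field_simp
    linear_combination hc - p * (k + 1) * he - (k + 1) ^ 2 * h

/-- The ratios to the odd binomial are `(p+k+1)/(2k+2)` and `(p-k-1)/(2k+2)`. That binomial is
already divisible by `p`, so only `±1/2` matters. -/
theorem congMod_choose_even (hpn : p = 2 * n + 1) {k : ℕ} (hk : k < n) :
    CongMod p 2 ((p + k + 1).choose (2 * k + 2) : ℚ) (p * (altInvCentral k / 2)) ∧
    CongMod p 2 ((p + k).choose (2 * k + 2) : ℚ) (-(p * (altInvCentral k / 2))) := by
  have hpn' : (p : ℚ) = 2 * n + 1 := by exact_mod_cast hpn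
  obtain ⟨z, hz, h⟩ := congMod_choose_odd hpn hk
  have hmem := altInvCentral_mem hpn hk
  have hinv : ((2 * k + 2 : ℕ) : ℚ)⁻¹ ∈ pIntegers p :=
    inv_mem_pIntegers_of_lt (by omega) (by omega)
  have h4 : (2 * (k : ℚ) + 2) ≠ 0 := by positivity
  have h1 := choose_succ_even_eq (2 * n) k
  have h2 := choose_even_eq (2 * n) k
  rw [← hpn] at h1 h2
  push_cast at h1 h2
  have hz1 : altInvCentral k + p * z ∈ pIntegers p :=
    add_mem hmem (mul_mem (natCast_mem _ _) hz)
  have hz2 : ((k + 1 : ℕ) : ℚ) * z ∈ pIntegers p := mul_mem (natCast_mem _ _) hz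
  constructor
  · refine ⟨((2 * k + 2 : ℕ) : ℚ)⁻¹ * ((altInvCentral k + p * z) + (k + 1 : ℕ) * z),
      mul_mem hinv (add_mem hz1 hz2), ?_⟩
    push_cast
    field_simp
    linear_combination h1 + (p + k + 1) * h - ((p + k).choose (2 * k + 1) : ℚ) * hpn'
  · refine ⟨((2 * k + 2 : ℕ) : ℚ)⁻¹ * ((altInvCentral k + p * z) - (k + 1 : ℕ) * z),
      mul_mem hinv (sub_mem hz1 hz2), ?_⟩
    push_cast
    field_simp
    linear_combination h2 + (p - k - 1) * h - ((p + k).choose (2 * k + 1) : ℚ) * hpn'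

/-- The truncation `∑_{i<p} C(i+k, 2k) t^i` of the power series `t^k / (1-t)^(2k+1)`. -/
def truncBinomSeries (p k : ℕ) (t : ℚ) : ℚ :=
  ∑ i ∈ Finset.range p, ((i + k).choose (2 * k) : ℚ) * t ^ i

theorem truncBinomSeries_mem {t : ℚ} (ht : t ∈ pIntegers p) (k : ℕ) :
    truncBinomSeries p k t ∈ pIntegers p :=
  sum_mem fun _ _ => mul_mem (natCast_mem _ _) (pow_mem ht _)

theorem congMod_truncBinomSeries_succ (hpn : p = 2 * n + 1) {k : ℕ} (hk : k < n) {t : ℚ}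
    (ht0 : t ≠ 0) (ht : t ∈ pIntegers p) (ht' : t⁻¹ ∈ pIntegers p) :
    CongMod p 2 ((1 - t) ^ 2 / t * truncBinomSeries p (k + 1) t)
      (truncBinomSeries p k t - p * ((1 + t) / 2 * altInvCentral k)) := by
  obtain ⟨h1, h2⟩ := congMod_choose_even hpn hk
  have hrec := mul_sum_choose_mul_pow k p t
  change t * truncBinomSeries p k t = (1 - t) ^ 2 * truncBinomSeries p (k + 1) t + _ - _ at hrec
  have h3 := (h1.mul_left (pow_mem ht p)).sub (h2.mul_left (pow_mem ht (p + 1)))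
  have hinv2 := inv_two_pow_mem (p := p) hpn 1
  rw [pow_one] at hinv2
  have hc : (1 + t) * (altInvCentral k * 2⁻¹) ∈ pIntegers p :=
    mul_mem (add_mem (one_mem _) ht) (mul_mem (altInvCentral_mem hpn hk) hinv2)
  have h4 := ((congMod_one_pow_prime ht).mul_right hc).prime_mul
  have h5 := (((CongMod.refl (t * truncBinomSeries p k t)).sub
    (h3.trans ((CongMod.of_eq (by ring)).trans h4))).mul_left ht')
  refine (CongMod.of_eq ?_).trans (h5.trans (CongMod.of_eq ?_))
  · rw [hrec]; field_simp; ring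
  · field_simp

theorem congMod_pow_mul_truncBinomSeries (hpn : p = 2 * n + 1) {k : ℕ} (hk : k ≤ n) {t : ℚ}
    (ht0 : t ≠ 0) (ht : t ∈ pIntegers p) (ht' : t⁻¹ ∈ pIntegers p) :
    CongMod p 2 (((1 - t) ^ 2 / t) ^ k * truncBinomSeries p k t)
      (truncBinomSeries p 0 t - p * ((1 + t) / 2) *
        ∑ j ∈ Finset.range k, ((1 - t) ^ 2 / t) ^ j * altInvCentral j) := by
  induction k with
  | zero => exact CongMod.of_eq (by simp)
  | succ k ih =>
    have hy : (1 - t) ^ 2 / t ∈ pIntegers p :=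
      mul_mem (pow_mem (sub_mem (one_mem _) ht) _) ht'
    have h := (congMod_truncBinomSeries_succ hpn hk ht0 ht ht').mul_left (pow_mem hy k)
    have h1 := (ih (by omega)).sub (CongMod.refl (((1 - t) ^ 2 / t) ^ k *
      (p * ((1 + t) / 2 * altInvCentral k))))
    refine (CongMod.of_eq ?_).trans (h.trans ((CongMod.of_eq ?_).trans
      (h1.trans (CongMod.of_eq ?_))))
    · ring
    · ring
    · rw [Finset.sum_range_succ]; ring

/-- `4(n+k+1)(n-k) = p² - (2k+1)²`, so mod `p²` the two sides have the same ratio of consecutive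
terms. -/
theorem congMod_centralChoose (hpn : p = 2 * n + 1) {k : ℕ} (hk : k ≤ n) :
    CongMod p 2 ((2 * k).choose k : ℚ) ((-16) ^ k * ((n + k).choose (2 * k) : ℚ)) := by
  induction k with
  | zero => exact CongMod.of_eq (by simp)
  | succ k ih =>
    obtain ⟨z, hz, h⟩ := ih (by omega)
    have hc := choose_add_succ_two_mul n k
    have hb := succ_mul_centralChoose_succ k
    have hpn' : (p : ℚ) = 2 * n + 1 := by exact_mod_cast hpn
    have h1 : ((2 * k + 1 : ℕ) : ℚ)⁻¹ ∈ pIntegers p :=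
      inv_mem_pIntegers_of_lt (by omega) (by omega)
    have h2 : ((k + 1 : ℕ) : ℚ)⁻¹ ∈ pIntegers p :=
      inv_mem_pIntegers_of_lt (by omega) (by omega)
    refine ⟨((2 * k + 1 : ℕ) : ℚ)⁻¹ * ((k + 1 : ℕ) : ℚ)⁻¹ *
      (2 * (2 * k + 1 : ℕ) ^ 2 * z + 2 * ((-16) ^ k * ((n + k).choose (2 * k) : ℕ))),
      mul_mem (mul_mem h1 h2) (add_mem (mul_mem (mul_mem (ofNat_mem _ 2)
        (pow_mem (natCast_mem _ _) _)) hz) (mul_mem (ofNat_mem _ 2)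
        (mul_mem (pow_mem (neg_mem (ofNat_mem _ 16)) _) (natCast_mem _ _)))), ?_⟩
    have h3 : (2 * (k : ℚ) + 1) ≠ 0 := by positivity
    have h4 : ((k : ℚ) + 1) ≠ 0 := by positivity
    push_cast
    field_simp
    rw [hpn'] at h ⊢
    rw [pow_succ (-16 : ℚ)]
    linear_combination (2 * (k : ℚ) + 1) * hb + 2 * (2 * k + 1) ^ 2 * h + 8 * (-16) ^ k * hc

theorem congMod_centralChoose_sq (hpn : p = 2 * n + 1) {k : ℕ} (hk : k ≤ n) :
    CongMod p 2 (((2 * k).choose k : ℚ) ^ 2 / 16 ^ k) (legendreCoeff n k) := by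
  have h16 : ((16 : ℚ) ^ k)⁻¹ ∈ pIntegers p := by
    have := inv_two_pow_mem (p := p) hpn (4 * k)
    rw [pow_mul] at this
    norm_num at this
    exact this
  have h := (congMod_centralChoose hpn hk).mul_left
    (mul_mem (natCast_mem (pIntegers p) ((2 * k).choose k)) h16)
  refine (CongMod.of_eq ?_).trans (h.trans (CongMod.of_eq ?_))
  · ring
  · rw [legendreCoeff, neg_pow (16 : ℚ)]
    field_simp

/-- Since `n ≡ -1/2` mod `p`, this is `C(2k,k) = (-4)^k C(-1/2,k)` reduced. -/
theorem congMod_centralChoose_choose (hpn : p = 2 * n + 1) {k : ℕ} (hk : k ≤ n) :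
    CongMod p 1 ((2 * k).choose k : ℚ) ((-4) ^ k * (n.choose k : ℚ)) := by
  induction k with
  | zero => exact CongMod.of_eq (by simp)
  | succ k ih =>
    obtain ⟨z, hz, h⟩ := ih (by omega)
    have hc := congrArg (Nat.cast : ℕ → ℚ) (Nat.choose_succ_right_eq n k)
    have hb := succ_mul_centralChoose_succ k
    have hpn' : (p : ℚ) = 2 * n + 1 := by exact_mod_cast hpn
    have h2 : ((k + 1 : ℕ) : ℚ)⁻¹ ∈ pIntegers p :=
      inv_mem_pIntegers_of_lt (by omega) (by omega)
    refine ⟨((k + 1 : ℕ) : ℚ)⁻¹ *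
      (2 * (2 * k + 1 : ℕ) * z + 2 * ((-4) ^ k * (n.choose k : ℕ))),
      mul_mem h2 (add_mem (mul_mem (mul_mem (ofNat_mem _ 2) (natCast_mem _ _)) hz)
        (mul_mem (ofNat_mem _ 2)
          (mul_mem (pow_mem (neg_mem (ofNat_mem _ 4)) _) (natCast_mem _ _)))), ?_⟩
    have h4 : ((k : ℚ) + 1) ≠ 0 := by positivity
    push_cast [Nat.cast_sub (show k ≤ n by omega)] at hc ⊢
    field_simp
    rw [pow_one, hpn'] at h
    rw [hpn']
    rw [pow_succ]
    linear_combination hb + 2 * (2 * k + 1) * h + 4 * (-4) ^ k * hc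

theorem congMod_centralChoose_zero (hpn : p = 2 * n + 1) {k : ℕ} (hk : n < k) (hkp : k < p) :
    CongMod p 1 ((2 * k).choose k : ℚ) 0 := by
  have h : p ∣ (2 * k).choose k := by
    rw [two_mul]
    exact Nat.Prime.dvd_choose_add Fact.out hkp hkp (by omega)
  obtain ⟨z, hz⟩ := h
  exact ⟨z, natCast_mem _ _, by rw [hz]; push_cast; ring⟩

theorem congMod_centralChoose_sq_zero (hpn : p = 2 * n + 1) {k : ℕ} (hk : n < k) (hkp : k < p) :
    CongMod p 2 (((2 * k).choose k : ℚ) ^ 2) 0 := by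
  obtain ⟨z, hz, h⟩ := congMod_centralChoose_zero hpn hk hkp
  refine ⟨z ^ 2, pow_mem hz _, ?_⟩
  rw [sub_zero] at *
  rw [h]; ring

/-! ### Reduction to truncated series, and part (i). -/

theorem sum_genTrinomial_sq_div_pow (p : ℕ) (b c d : ℤ) (hd : d = b ^ 2 - 4 * c) (hd0 : d ≠ 0)
    (m : ℚ) :
    ∑ i ∈ Finset.range p, (genTrinomial i b c : ℚ) ^ 2 / m ^ i =
      ∑ k ∈ Finset.range p, ((2 * k).choose k : ℚ) ^ 2 * ((c : ℚ) / d) ^ k *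
        truncBinomSeries p k (d / m) := by
  have hdq : (d : ℚ) ≠ 0 := by exact_mod_cast hd0
  simp_rw [truncBinomSeries, Finset.mul_sum]
  rw [Finset.sum_comm]
  refine Finset.sum_congr rfl fun i hi => ?_
  have hi := Finset.mem_range.mp hi
  rw [genTrinomial_sq i b c d hd, Finset.sum_div, ← Finset.sum_subset
    (Finset.range_subset_range.mpr (show i + 1 ≤ p by omega))]
  · refine Finset.sum_congr rfl fun k hk => ?_
    have hk := Nat.lt_succ_iff.mp (Finset.mem_range.mp hk)
    rw [div_pow, div_pow]
    have : (d : ℚ) ^ i = d ^ (i - k) * d ^ k := by rw [← pow_add, Nat.sub_add_cancel hk]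
    rw [this]
    field_simp
  · intro k _ hk
    rw [Finset.mem_range, not_lt] at hk
    rw [Nat.choose_eq_zero_of_lt (show i + k < 2 * k by omega)]
    simp

theorem congMod_sum_genTrinomial_sq (hpn : p = 2 * n + 1) (b c d m : ℤ)
    (hd : d = b ^ 2 - 4 * c) (hpd : ¬ (p : ℤ) ∣ d) (hpm : ¬ (p : ℤ) ∣ m) :
    CongMod p 2 (∑ i ∈ Finset.range p, (genTrinomial i b c : ℚ) ^ 2 / (m : ℚ) ^ i)
      (∑ k ∈ Finset.range (n + 1), ((2 * k).choose k : ℚ) ^ 2 * ((c : ℚ) / d) ^ k *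
        truncBinomSeries p k (d / m)) := by
  have hd0 : d ≠ 0 := fun h => hpd (h ▸ dvd_zero _)
  rw [sum_genTrinomial_sq_div_pow p b c d hd hd0]
  refine CongMod.sum_range_of_le (by omega) fun k hk hkp => ?_
  have hmem : ((c : ℚ) / d) ^ k * truncBinomSeries p k (d / m) ∈ pIntegers p :=
    mul_mem (pow_mem (mul_mem (intCast_mem _ _) (inv_intCast_mem_pIntegers hpd)) _)
      (truncBinomSeries_mem (mul_mem (intCast_mem _ _) (inv_intCast_mem_pIntegers hpm)) _)
  have h := (congMod_centralChoose_sq_zero hpn hk hkp).mul_right hmem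
  rwa [zero_mul, ← mul_assoc] at h

theorem truncBinomSeries_zero (p : ℕ) (t : ℚ) :
    truncBinomSeries p 0 t = ∑ i ∈ Finset.range p, t ^ i := by
  simp [truncBinomSeries]

theorem congMod_sum_genTrinomial_sq_neg (hpn : p = 2 * n + 1) (b c d : ℤ)
    (hd : d = b ^ 2 - 4 * c) (hpd : ¬ (p : ℤ) ∣ d) :
    CongMod p 2 (∑ i ∈ Finset.range p, (genTrinomial i b c : ℚ) ^ 2 / (-(d : ℚ)) ^ i)
      (∑ k ∈ Finset.range (n + 1), ((2 * k).choose k : ℚ) ^ 2 * (-((c : ℚ) / (4 * d))) ^ k) := by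
  have hdq : (d : ℚ) ≠ 0 := by
    rintro h
    exact hpd ((Int.cast_eq_zero.mp h) ▸ dvd_zero _)
  have h := congMod_sum_genTrinomial_sq hpn b c d (-d) hd hpd (by rwa [dvd_neg])
  rw [Int.cast_neg, div_neg, div_self hdq] at h
  refine h.trans (CongMod.sum fun k hk => ?_)
  have h4 : ((2 : ℚ) ^ 2)⁻¹ ∈ pIntegers p := inv_two_pow_mem hpn 2
  norm_num at h4
  have hmem : ((2 * k).choose k : ℚ) ^ 2 * (-((c : ℚ) / (4 * d))) ^ k ∈ pIntegers p := by
    refine mul_mem (pow_mem (natCast_mem _ _) _) (pow_mem (neg_mem ?_) _)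
    rw [div_eq_mul_inv, mul_inv]
    exact mul_mem (intCast_mem _ _) (mul_mem (by simpa using h4) (inv_intCast_mem_pIntegers hpd))
  have hB := (congMod_pow_mul_truncBinomSeries hpn (Nat.lt_succ_iff.mp (Finset.mem_range.mp hk))
    (t := -1) (by norm_num) (neg_mem (one_mem _))
    (by rw [inv_neg, inv_one]; exact neg_mem (one_mem _))).mul_left hmem
  refine (CongMod.of_eq ?_).trans (hB.trans (CongMod.of_eq ?_))
  -- At `t = -1`, `y = -4`, which supplies the `-1/4` of the statement.
  · have : (c : ℚ) / d = -(c / (4 * d)) * ((1 - -1) ^ 2 / -1) := by field_simp; norm_num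
    rw [this, mul_pow]; ring
  · have : truncBinomSeries p 0 (-1) = 1 := by
      rw [truncBinomSeries_zero, hpn, Finset.sum_range_succ, neg_one_geom_sum]
      simp
    rw [this]
    norm_num

/-! ### The sums `S_{p-1}`, Fermat quotients and part (ii). -/

theorem congMod_centralBinomSum (hpn : p = 2 * n + 1) {x : ℚ} (hx : x ∈ pIntegers p) :
    CongMod p 1 (centralBinomSum p x)
      (∑ k ∈ Finset.range n, (n.choose (k + 1) : ℚ) * (-(4 * x)) ^ (k + 1) / ((k : ℚ) + 1)) := by
  have hmem : ∀ k, k + 1 < p → ((k + 1 : ℕ) : ℚ)⁻¹ * x ^ (k + 1) ∈ pIntegers p := fun k hk =>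
    mul_mem (inv_mem_pIntegers_of_lt (by omega) hk) (pow_mem hx _)
  have hS : centralBinomSum p x = ∑ k ∈ Finset.range (2 * n),
      ((2 * (k + 1)).choose (k + 1) : ℚ) * (((k + 1 : ℕ) : ℚ)⁻¹ * x ^ (k + 1)) := by
    have : Finset.Icc 1 (p - 1) = Finset.Ico 1 (2 * n + 1) := by
      ext k; simp only [Finset.mem_Icc, Finset.mem_Ico]; omega
    rw [centralBinomSum, this, Finset.sum_Ico_eq_sum_range]
    refine Finset.sum_congr rfl fun k _ => ?_
    rw [add_comm 1 k]
    ring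
  rw [hS]
  refine (CongMod.sum_range_of_le (N := n) (by omega) fun k hk hk' => ?_).trans
    (CongMod.sum fun k hk => ?_)
  · have := (congMod_centralChoose_zero (p := p) hpn (k := k + 1) (by omega) (by omega)).mul_right
      (hmem k (by omega))
    rwa [zero_mul] at this
  · have hk := Finset.mem_range.mp hk
    refine ((congMod_centralChoose_choose hpn (k := k + 1) (by omega)).mul_right
      (hmem k (by omega))).trans (CongMod.of_eq ?_)
    rw [← neg_mul, mul_pow]
    push_cast
    ring

theorem congMod_centralBinomSum_sub (hpn : p = 2 * n + 1) {t : ℚ}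
    (ht : t ∈ pIntegers p) (ht' : t⁻¹ ∈ pIntegers p) :
    CongMod p 1 (centralBinomSum p ((1 + t) / 4) - centralBinomSum p ((1 + t⁻¹) / 4))
      (∑ i ∈ Finset.range n, ((-t) ^ (i + 1) - (-t⁻¹) ^ (i + 1)) / ((i : ℚ) + 1)) := by
  have h4 : ((2 : ℚ) ^ 2)⁻¹ ∈ pIntegers p := inv_two_pow_mem hpn 2
  norm_num at h4
  have h4' : (4 : ℚ)⁻¹ ∈ pIntegers p := by simpa using h4
  have h := (congMod_centralBinomSum hpn (mul_mem (add_mem (one_mem _) ht) h4')).sub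
    (congMod_centralBinomSum hpn (mul_mem (add_mem (one_mem _) ht') h4'))
  refine h.trans (CongMod.of_eq ?_)
  -- With `s = 1 + t` one has `1 - s = -t`; the terms `-1/i` cancel in the difference.
  rw [show 4 * ((1 + t) * 4⁻¹) = 1 + t by ring, show 4 * ((1 + t⁻¹) * 4⁻¹) = 1 + t⁻¹ by ring,
    sum_choose_mul_pow_div, sum_choose_mul_pow_div, ← Finset.sum_sub_distrib]
  refine Finset.sum_congr rfl fun i _ => ?_
  ring

theorem congMod_truncBinomSeries_zero (hp : 1 ≤ p) {d m : ℤ} (hpd : ¬ (p : ℤ) ∣ d)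
    (hpm : ¬ (p : ℤ) ∣ m) (hdm : ¬ (p : ℤ) ∣ d - m) :
    CongMod p 2 (truncBinomSeries p 0 ((d : ℚ) / m))
      (1 + p * (d / (d - m)) * (fermatQuotient p d - fermatQuotient p m)) := by
  have hm0 : (m : ℚ) ≠ 0 := fun h => hpm ((Int.cast_eq_zero.mp h) ▸ dvd_zero _)
  have hdm0 : ((d : ℚ) - m) ≠ 0 := sub_ne_zero.mpr fun h =>
    hdm (by simp [Int.cast_injective h])
  have hp0 : (p : ℚ) ≠ 0 := by positivity
  obtain ⟨u, hu, h1⟩ := congMod_one_pow_sub_one hpd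
  obtain ⟨v, hv, h2⟩ := congMod_one_pow_sub_one hpm
  have hinv : ((d - m : ℤ) : ℚ)⁻¹ ∈ pIntegers p := inv_intCast_mem_pIntegers hdm
  have hminv := pow_mem (inv_intCast_mem_pIntegers hpm) (p - 1)
  -- With `d^(p-1) = 1 + pu` and `m^(p-1) = 1 + pv`, the geometric sum is exactly `1 + p d/(d-m)
  -- (u-v)/(1+pv)`; the witness is the error of replacing `1/(1+pv)` by `1`.
  refine ⟨-(d * ((d - m : ℤ) : ℚ)⁻¹ * (m : ℚ)⁻¹ ^ (p - 1) * (v * (u - v))),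
    neg_mem (mul_mem (mul_mem (mul_mem (intCast_mem _ _) hinv) hminv)
      (mul_mem hv (sub_mem hu hv))), ?_⟩
  have ht1 : (d : ℚ) / m ≠ 1 := by
    intro h
    rw [div_eq_one_iff_eq hm0] at h
    exact hdm0 (sub_eq_zero.mpr h)
  have hpow : ((d : ℚ) / m) ^ p = d * d ^ (p - 1) / (m * m ^ (p - 1)) := by
    rw [← pow_succ', ← pow_succ', Nat.sub_add_cancel hp, div_pow]
  rw [truncBinomSeries_zero, geom_sum_eq ht1, hpow, fermatQuotient, fermatQuotient, inv_pow]
  rw [pow_one] at h1 h2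
  have hu' : (d : ℚ) ^ (p - 1) = 1 + p * u := by linear_combination h1
  have hv' : (m : ℚ) ^ (p - 1) = 1 + p * v := by linear_combination h2
  have hv0 : (1 + p * v : ℚ) ≠ 0 := by rw [← hv']; exact pow_ne_zero _ hm0
  have hdm1 : (d : ℚ) / m - 1 = (d - m) / m := by field_simp
  rw [hu', hv', hdm1]
  push_cast
  field_simp
  ring

theorem congMod_sum_genTrinomial_sq_of_eq (hpn : p = 2 * n + 1) (b c d m : ℤ)
    (hd : d = b ^ 2 - 4 * c) (hm : (m - d) ^ 2 = 16 * m * c) (hpd : ¬ (p : ℤ) ∣ d)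
    (hpm : ¬ (p : ℤ) ∣ m) (hdm : ¬ (p : ℤ) ∣ d - m) :
    CongMod p 2 (∑ i ∈ Finset.range p, (genTrinomial i b c : ℚ) ^ 2 / (m : ℚ) ^ i)
      ((-1) ^ n + p * (d / (d - m)) * (-1) ^ n * (fermatQuotient p d - fermatQuotient p m +
        (centralBinomSum p ((1 + (d / m : ℚ)) / 4) -
          centralBinomSum p ((1 + (d / m : ℚ)⁻¹) / 4)))) := by
  have hm0 : (m : ℚ) ≠ 0 := fun h => hpm ((Int.cast_eq_zero.mp h) ▸ dvd_zero _)
  have hd0 : (d : ℚ) ≠ 0 := fun h => hpd ((Int.cast_eq_zero.mp h) ▸ dvd_zero _)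
  have hdm0 : ((d : ℚ) - m) ≠ 0 := sub_ne_zero.mpr fun h =>
    hdm (by simp [Int.cast_injective h])
  have hinv : ((d - m : ℤ) : ℚ)⁻¹ ∈ pIntegers p := inv_intCast_mem_pIntegers hdm
  push_cast at hinv
  have ht : (d : ℚ) / m ∈ pIntegers p :=
    mul_mem (intCast_mem _ _) (inv_intCast_mem_pIntegers hpm)
  have ht' : ((d : ℚ) / m)⁻¹ ∈ pIntegers p := by
    rw [inv_div]
    exact mul_mem (intCast_mem _ _) (inv_intCast_mem_pIntegers hpd)
  have ht0 : (d : ℚ) / m ≠ 0 := div_ne_zero hd0 hm0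
  have hB0 := congMod_truncBinomSeries_zero (by omega) hpd hpm hdm
  have hratio : (d : ℚ) / (d - m) * (d / m - 1) = d / m := by field_simp
  set t : ℚ := (d : ℚ) / m with htdef
  set r : ℚ := (d : ℚ) / (d - m) with hr
  have hrmem : r ∈ pIntegers p := mul_mem (intCast_mem _ _) hinv
  set y := (1 - t) ^ 2 / t with hy
  have hymem : y ∈ pIntegers p := mul_mem (pow_mem (sub_mem (one_mem _) ht) _) ht'
  -- The condition on `m` enters only here: it makes `(c/d)^k` supply the `y^k` needed by
  -- `congMod_pow_mul_truncBinomSeries` and the `16^k` needed by `congMod_centralChoose_sq`.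
  have hcd : (c : ℚ) / d = y / 16 := by
    have hmq : ((m : ℚ) - d) ^ 2 = 16 * m * c := by exact_mod_cast hm
    rw [hy, htdef]
    field_simp
    linear_combination -hmq
  have hneg : ((-1 : ℚ) ^ n) ∈ pIntegers p := pow_mem (neg_mem (one_mem _)) _
  have hcoef : ∀ k, legendreCoeff n k ∈ pIntegers p := fun k =>
    mul_mem (mul_mem (pow_mem (neg_mem (one_mem _)) _) (natCast_mem _ _)) (natCast_mem _ _)
  refine (congMod_sum_genTrinomial_sq hpn b c d m hd hpd hpm).trans ?_
  have h1 : CongMod p 2 (∑ k ∈ Finset.range (n + 1), ((2 * k).choose k : ℚ) ^ 2 *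
      ((c : ℚ) / d) ^ k * truncBinomSeries p k t)
      (∑ k ∈ Finset.range (n + 1), legendreCoeff n k * (truncBinomSeries p 0 t -
        p * ((1 + t) / 2) * ∑ j ∈ Finset.range k, y ^ j * altInvCentral j)) := by
    refine CongMod.sum fun k hk => ?_
    have hk := Nat.lt_succ_iff.mp (Finset.mem_range.mp hk)
    refine (CongMod.of_eq ?_).trans (((congMod_centralChoose_sq hpn hk).mul_right
      (mul_mem (pow_mem hymem k) (truncBinomSeries_mem ht k))).trans
      ((congMod_pow_mul_truncBinomSeries hpn hk ht0 ht ht').mul_left (hcoef k)))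
    rw [hcd, div_pow]
    ring
  refine h1.trans ?_
  have h2 : ∑ k ∈ Finset.range (n + 1), legendreCoeff n k * (truncBinomSeries p 0 t -
        p * ((1 + t) / 2) * ∑ j ∈ Finset.range k, y ^ j * altInvCentral j) =
      (-1) ^ n * truncBinomSeries p 0 t + p * (r * (-1) ^ n *
        ∑ i ∈ Finset.range n, ((-t) ^ (i + 1) - (-t⁻¹) ^ (i + 1)) / ((i : ℚ) + 1)) := by
    have hV := sum_pow_mul_altChooseSum ht0 n
    rw [← hy] at hV
    have hsplit : ∑ k ∈ Finset.range (n + 1), legendreCoeff n k * (truncBinomSeries p 0 t -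
        p * ((1 + t) / 2) * ∑ j ∈ Finset.range k, y ^ j * altInvCentral j) =
        (∑ k ∈ Finset.range (n + 1), legendreCoeff n k) * truncBinomSeries p 0 t -
        p * ((1 + t) / 2) * ∑ k ∈ Finset.range (n + 1), legendreCoeff n k *
          ∑ j ∈ Finset.range k, y ^ j * altInvCentral j := by
      rw [Finset.sum_mul, Finset.mul_sum, ← Finset.sum_sub_distrib]
      exact Finset.sum_congr rfl fun k _ => by ring
    rw [hsplit, sum_legendreCoeff, sum_legendreCoeff_mul_sum]
    have ht1 : t - 1 ≠ 0 := by
      intro h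
      rw [h, mul_zero] at hratio
      exact ht0 hratio.symm
    -- The factor `1 + t` of the correction completes `t - 1` to the `t² - 1` of `hV`, leaving
    -- `t/(t-1) = r`.
    apply mul_left_cancel₀ ht1
    linear_combination p * (-1) ^ n * hV - p * (-1) ^ n *
      (∑ i ∈ Finset.range n, ((-t) ^ (i + 1) - (-t⁻¹) ^ (i + 1)) / ((i : ℚ) + 1)) * hratio
  rw [h2]
  have h3 := (hB0.mul_left hneg).add ((congMod_centralBinomSum_sub hpn ht ht').symm.mul_left
    (mul_mem hrmem hneg)).prime_mul
  refine h3.trans (CongMod.of_eq ?_)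
  ring

theorem fermatQuotient_mem {a : ℤ} (h : ¬ (p : ℤ) ∣ a) : fermatQuotient p a ∈ pIntegers p := by
  obtain ⟨z, hz, hz'⟩ := congMod_one_pow_sub_one h
  have hp0 : (p : ℚ) ≠ 0 := by exact_mod_cast (Fact.out : p.Prime).ne_zero
  have : fermatQuotient p a = z := by
    rw [fermatQuotient, hz', pow_one, mul_div_cancel_left₀ _ hp0]
  rwa [this]

theorem centralBinomSum_mem {x : ℚ} (hx : x ∈ pIntegers p) :
    centralBinomSum p x ∈ pIntegers p := by
  have hp : p.Prime := Fact.out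
  refine sum_mem fun k hk => mul_mem (mul_mem (natCast_mem _ _) ?_) (pow_mem hx _)
  have hk := Finset.mem_Icc.mp hk
  exact inv_mem_pIntegers_of_lt hk.1 (by have := hp.one_lt; omega)

theorem legendreSym_neg_one_eq (hpn : p = 2 * n + 1) : legendreSym p (-1) = (-1) ^ n := by
  rw [legendreSym.at_neg_one (by omega), ZMod.χ₄_eq_neg_one_pow (by omega),
    show p / 2 = n by omega]

end TrinomialSquare

/-! ### Assembly, with `p`-integrality of the right-hand sides. -/

open TrinomialSquare

theorem theorem1p1 (p : ℕ) [Fact p.Prime] (hp : Odd p) (b c d : ℤ) (hd : d = b ^ 2 - 4 * c) :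
    (¬ (p : ℤ) ∣ d →
      RatModEq p 2
        (∑ k ∈ Finset.range p, (genTrinomial k b c : ℚ) ^ 2 / (-(d : ℚ)) ^ k)
        (∑ l ∈ Finset.range ((p - 1) / 2 + 1),
          ((Nat.choose (2 * l) l : ℕ) : ℚ) ^ 2 * (-((c : ℚ) / (4 * (d : ℚ)))) ^ l)) ∧
    (∀ m : ℤ, (m - d) ^ 2 = 16 * m * c → ¬ (p : ℤ) ∣ m * d * (m - d) →
      RatModEq p 2
        (∑ k ∈ Finset.range p, (genTrinomial k b c : ℚ) ^ 2 / (m : ℚ) ^ k)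
        ((legendreSym p (-1) : ℚ) +
          (p : ℚ) * (d : ℚ) / ((d : ℚ) - (m : ℚ)) * (legendreSym p (-1) : ℚ) *
            (fermatQuotient p d - fermatQuotient p m
              + centralBinomSum p (((m : ℚ) + (d : ℚ)) / (4 * (m : ℚ)))
              - centralBinomSum p (((m : ℚ) + (d : ℚ)) / (4 * (d : ℚ)))))) := by
  obtain ⟨n, hpn⟩ := hp
  have hn : (p - 1) / 2 = n := by omega
  have h4 : ((2 : ℚ) ^ 2)⁻¹ ∈ pIntegers p := inv_two_pow_mem hpn 2
  norm_num at h4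
  have h4' : (4 : ℚ)⁻¹ ∈ pIntegers p := by simpa using h4
  constructor
  · intro hpd
    rw [hn]
    refine (congMod_sum_genTrinomial_sq_neg hpn b c d hd hpd).ratModEq (sum_mem fun k _ =>
      mul_mem (pow_mem (natCast_mem _ _) _) (pow_mem (neg_mem ?_) _))
    rw [div_eq_mul_inv, mul_inv]
    exact mul_mem (intCast_mem _ _) (mul_mem h4' (inv_intCast_mem_pIntegers hpd))
  · intro m hm hpmd
    have hpm : ¬ (p : ℤ) ∣ m := fun h => hpmd ((h.mul_right d).mul_right _)
    have hpd : ¬ (p : ℤ) ∣ d := fun h => hpmd ((h.mul_left m).mul_right _)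
    have hdm : ¬ (p : ℤ) ∣ d - m := fun h =>
      hpmd (((dvd_sub_comm).mp h).mul_left _)
    have hm0 : (m : ℚ) ≠ 0 := fun h => hpm ((Int.cast_eq_zero.mp h) ▸ dvd_zero _)
    have hd0 : (d : ℚ) ≠ 0 := fun h => hpd ((Int.cast_eq_zero.mp h) ▸ dvd_zero _)
    have hinv : ((d - m : ℤ) : ℚ)⁻¹ ∈ pIntegers p := inv_intCast_mem_pIntegers hdm
    push_cast at hinv
    have ht : (d : ℚ) / m ∈ pIntegers p :=
      mul_mem (intCast_mem _ _) (inv_intCast_mem_pIntegers hpm)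
    have ht' : ((d : ℚ) / m)⁻¹ ∈ pIntegers p := by
      rw [inv_div]
      exact mul_mem (intCast_mem _ _) (inv_intCast_mem_pIntegers hpd)
    have hneg : ((-1 : ℚ) ^ n) ∈ pIntegers p := pow_mem (neg_mem (one_mem _)) _
    have e1 : ((m : ℚ) + d) / (4 * m) = (1 + (d / m : ℚ)) / 4 := by field_simp
    have e2 : ((m : ℚ) + d) / (4 * d) = (1 + (d / m : ℚ)⁻¹) / 4 := by
      rw [inv_div]; field_simp; ring
    rw [legendreSym_neg_one_eq hpn, e1, e2]
    push_cast
    rw [add_sub_assoc, mul_div_assoc]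
    refine (congMod_sum_genTrinomial_sq_of_eq hpn b c d m hd hm hpd hpm hdm).ratModEq ?_
    refine add_mem hneg (mul_mem (mul_mem (mul_mem (natCast_mem _ _)
      (mul_mem (intCast_mem _ _) hinv)) hneg) (add_mem (sub_mem (fermatQuotient_mem hpd)
      (fermatQuotient_mem hpm)) (sub_mem ?_ ?_)))
    · exact centralBinomSum_mem (mul_mem (add_mem (one_mem _) ht) h4')
    · exact centralBinomSum_mem (mul_mem (add_mem (one_mem _) ht') h4')
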